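/- Let a hypergraph $(V,\mathcal H)$ consist of a finite vertex set $V$ with $n=|V|$ and a set $\mathcal H\subseteq 2^V$ of $m=|\mathcal H|$ edges. It is conformal (that is, $2$-conformal) if for every $S\subseteq V$ the following are equivalent: (1) there is an edge $E\in\mathcal H$ with $S\subseteq E$; (2) for every $S'\subseteq S$ with $|S'|\le 2$ there is an edge $E'\in\mathcal H$ with $S'\subseteq E'$. Theorem. Conformal hypergraphs can be recognized in time $O(mn^3)$. Precisely, there is a deterministic algorithm on a unit-cost word RAM with words of $O(\log(n+m+2))$ bits that, given the incidence matrix of any hypergraph $(V,\mathcal H)$ (with the vertices and edges listed in any order), halts after $O(\max\{1,mn^3\})$ steps and decides correctly whether $\mathcal H$ is conformal. If $\mathcal H$ is not conformal, the algorithm also outputs a set $S\subseteq V$ such that each $S'\subseteq S$ with $|S'|\le 2$ is contained in some edge, but $S$ itself is contained in no edge. -/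

import Mathlib

/-! ### Conformal hypergraphs -/

/-- `H` is `k`-conformal: a set `S` of vertices is contained in an edge if and only if each of its
subsets with at most `k` elements is contained in an edge. -/
def Hypergraph.IsConformal {α : Type*} (k : ℕ) (H : Hypergraph α) : Prop :=
  ∀ S : Set α, S ⊆ H.vertexSet →
    ((∃ E ∈ H.edgeSet, S ⊆ E) ↔
      ∀ S' : Set α, S' ⊆ S → S'.encard ≤ k → ∃ E' ∈ H.edgeSet, S' ⊆ E')

/-- `S` is a counterexample to the `k`-conformality of `H`: a set of vertices whose subsets with at
most `k` elements are all contained in edges, while `S` itself is contained in no edge. -/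
def Hypergraph.IsNonconformalityWitness {α : Type*} (k : ℕ) (H : Hypergraph α) (S : Set α) :
    Prop :=
  S ⊆ H.vertexSet ∧
    (∀ S' : Set α, S' ⊆ S → S'.encard ≤ k → ∃ E' ∈ H.edgeSet, S' ⊆ E') ∧
    ∀ E ∈ H.edgeSet, ¬ S ⊆ E

/-! ### A word RAM with unit cost

A machine has registers and a random access memory. Every register and every memory cell that
an instruction writes must hold the result as a word of `w` bits; an instruction whose result does
not fit into a word cannot be executed. A program is a finite text (so it names finitely many
registers); it is fixed once and for all and does not depend on the input or on `w`. -/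

namespace WordRAM

/-- A configuration: the contents of the registers and of the memory cells. -/
structure State where
  reg : ℕ → ℕ
  mem : ℕ → ℕ

/-- The elementary instructions. -/
inductive Instr where
  /-- `reg d := v` for a constant `v` -/
  | const (d v : ℕ)
  /-- `reg d := reg a + reg b` -/
  | add (d a b : ℕ)
  /-- `reg d := reg a - reg b`, or `0` if this is negative -/
  | sub (d a b : ℕ)
  /-- `reg d := reg a * reg b` -/
  | mul (d a b : ℕ)
  /-- `reg d := mem (reg a)` -/
  | load (d a : ℕ)
  /-- `mem (reg a) := reg b` -/
  | store (a b : ℕ)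

/-- The value that an instruction writes. -/
def Instr.value (s : State) : Instr → ℕ
  | .const _ v => v
  | .add _ a b => s.reg a + s.reg b
  | .sub _ a b => s.reg a - s.reg b
  | .mul _ a b => s.reg a * s.reg b
  | .load _ a => s.mem (s.reg a)
  | .store _ b => s.reg b

/-- The configuration after an instruction. -/
def Instr.apply (s : State) (i : Instr) : State :=
  match i with
  | .const d _ | .add d _ _ | .sub d _ _ | .mul d _ _ | .load d _ =>
      { s with reg := Function.update s.reg d (i.value s) }
  | .store a _ => { s with mem := Function.update s.mem (s.reg a) (i.value s) }

/-- The tests: comparisons of two registers. -/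
inductive Test where
  | lt (a b : ℕ)
  | eq (a b : ℕ)

/-- The test succeeds. -/
def Test.Holds (s : State) : Test → Prop
  | .lt a b => s.reg a < s.reg b
  | .eq a b => s.reg a = s.reg b

/-- Programs: instructions, sequencing, branching and loops. -/
inductive Prog where
  | skip
  | instr (i : Instr)
  | seq (p q : Prog)
  | ite (b : Test) (p q : Prog)
  | while (b : Test) (p : Prog)

/-- `Exec w p s t s'`: on a machine with word length `w`, the program `p` started in the
configuration `s` halts after exactly `t` steps in the configuration `s'`. Each execution of an
instruction and each evaluation of a test is one step. At most one rule applies to each program and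
configuration, so `t` and `s'` are determined by `w`, `p` and `s`; a run that does not terminate or
that exceeds the word length has no derivation. -/
inductive Exec (w : ℕ) : Prog → State → ℕ → State → Prop where
  | skip (s : State) : Exec w .skip s 0 s
  | instr (i : Instr) (s : State) (h : i.value s < 2 ^ w) : Exec w (.instr i) s 1 (i.apply s)
  | seq {p q : Prog} {s₀ s₁ s₂ : State} {t₁ t₂ : ℕ} (h₁ : Exec w p s₀ t₁ s₁)
      (h₂ : Exec w q s₁ t₂ s₂) : Exec w (.seq p q) s₀ (t₁ + t₂) s₂
  | iteTrue {b : Test} {p q : Prog} {s s' : State} {t : ℕ} (hb : b.Holds s)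
      (h : Exec w p s t s') : Exec w (.ite b p q) s (1 + t) s'
  | iteFalse {b : Test} {p q : Prog} {s s' : State} {t : ℕ} (hb : ¬ b.Holds s)
      (h : Exec w q s t s') : Exec w (.ite b p q) s (1 + t) s'
  | whileTrue {b : Test} {p : Prog} {s₀ s₁ s₂ : State} {t₁ t₂ : ℕ} (hb : b.Holds s₀)
      (h₁ : Exec w p s₀ t₁ s₁) (h₂ : Exec w (.while b p) s₁ t₂ s₂) :
      Exec w (.while b p) s₀ (1 + t₁ + t₂) s₂
  | whileFalse {b : Test} {p : Prog} {s : State} (hb : ¬ b.Holds s) :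
      Exec w (.while b p) s 1 s

open Classical in
/-- The input configuration for a hypergraph with vertices `x 0, …, x (n - 1)` and edges
`e 0, …, e (m - 1)`: registers `0` and `1` hold `n` and `m`, the memory cells `0, …, m * n - 1` hold
the rows of the incidence matrix (cell `j * n + i` is `1` if `x i ∈ e j` and `0` otherwise), and
all other registers and cells are `0`. -/
noncomputable def incidenceInput {α : Type*} {n m : ℕ} (x : Fin n → α) (e : Fin m → Set α) :
    State where
  reg := fun r => if r = 0 then n else if r = 1 then m else 0
  mem := fun a => if ∃ (j : Fin m) (i : Fin n), a = j * n + i ∧ x i ∈ e j then 1 else 0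

end WordRAM

/-! Call two vertices adjacent if some edge contains both; a vertex is adjacent to itself exactly
when it lies in an edge. Apart from the empty set, the sets satisfying condition (2) are the cliques
of this relation, so conformality says that every clique lies in an edge.

It is enough to test `m * n` cliques. For an edge `E` and a vertex `v` that lies in some edge, the
set `(E ∩ N(v)) ∪ {v}` is a clique, called the seed of `E` and `v`. If every seed lies in an edge,
so does every clique, by induction on its size: when `M` lies in `E` and `M ∪ {v}` is a clique, `M ∪
{v}` lies in the seed of `E` and `v` (`covered_of_clique`).

Comparing a seed with all edges would cost `m * n` steps. Instead the seed is extended greedily to a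
maximal clique in `O(n ^ 2)` steps (`runs_greedyProg`). A maximal clique inside an edge equals that
edge, because edges are cliques; so containment becomes equality, which a trie of the edges decides
in `O(n)` steps (`TrieOf.walk_ne_zero_iff`, `runs_checkProg`). If the lookup fails, the maximal
clique is the required counterexample. The adjacency matrix costs `O(m * n ^ 2)`, the trie `O(m *
n)`, and the search `O(m * n ^ 3)`.

Running times come from a Hoare-style logic with step bounds. Nested loops use increasing frame
levels, so an inner computation keeps the counters of the outer loops. -/

namespace WordRAM

open Function

/-! ### A program logic with time bounds -/

/-- The program halts within `T` steps in a configuration that satisfies `Q`. -/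
def Runs (w T : ℕ) (p : Prog) (s : State) (Q : State → Prop) : Prop :=
  ∃ t s', Exec w p s t s' ∧ t ≤ T ∧ Q s'

theorem Runs.mono {w T T' : ℕ} {p : Prog} {s : State} {Q Q' : State → Prop}
    (h : Runs w T p s Q) (hT : T ≤ T') (hQ : ∀ s', Q s' → Q' s') : Runs w T' p s Q' := by
  obtain ⟨t, s', he, ht, hq⟩ := h
  exact ⟨t, s', he, ht.trans hT, hQ _ hq⟩

theorem Runs.skip {w : ℕ} {s : State} {Q : State → Prop} (h : Q s) : Runs w 0 .skip s Q :=
  ⟨0, s, .skip s, le_rfl, h⟩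

theorem Runs.seq {w T₁ T₂ : ℕ} {p q : Prog} {s : State} {R Q : State → Prop}
    (h₁ : Runs w T₁ p s R) (h₂ : ∀ s', R s' → Runs w T₂ q s' Q) :
    Runs w (T₁ + T₂) (.seq p q) s Q := by
  obtain ⟨t, s', he, ht, hr⟩ := h₁
  obtain ⟨t', s'', he', ht', hq⟩ := h₂ s' hr
  exact ⟨t + t', s'', .seq he he', by omega, hq⟩

theorem Runs.ite {w T : ℕ} {b : Test} {p q : Prog} {s : State} {Q : State → Prop}
    (h₁ : b.Holds s → Runs w T p s Q) (h₂ : ¬ b.Holds s → Runs w T q s Q) :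
    Runs w (1 + T) (.ite b p q) s Q := by
  by_cases hb : b.Holds s
  · obtain ⟨t, s', he, ht, hq⟩ := h₁ hb
    exact ⟨1 + t, s', .iteTrue hb he, by omega, hq⟩
  · obtain ⟨t, s', he, ht, hq⟩ := h₂ hb
    exact ⟨1 + t, s', .iteFalse hb he, by omega, hq⟩

/-- Straight-line code. -/
def block : List Instr → Prog
  | [] => .skip
  | i :: l => .seq (.instr i) (block l)

/-- All results of the straight-line code `l` are words. -/
def Fits (w : ℕ) : List Instr → State → Prop
  | [], _ => True
  | i :: l, s => i.value s < 2 ^ w ∧ Fits w l (i.apply s)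

/-- The registers below `L` agree. -/
def Frame (L : ℕ) (s s' : State) : Prop := ∀ r < L, s'.reg r = s.reg r

theorem Frame.refl (L : ℕ) (s : State) : Frame L s s := fun _ _ => rfl

theorem Frame.trans {L L' : ℕ} {s s' s'' : State} (h : Frame L s s') (h' : Frame L' s' s'')
    (hL : L ≤ L') : Frame L s s'' := fun r hr => (h' r (by omega)).trans (h r hr)

theorem Frame.update {L d v : ℕ} {s s' : State} {f : ℕ → ℕ} (h : Frame L s s') (hd : L ≤ d) :
    Frame L s ⟨update s'.reg d v, f⟩ := fun r hr => by
  rw [← h r hr]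
  exact update_of_ne (by omega) _ _

/-- The instruction does not write the registers below `L`. -/
def Instr.Above (L : ℕ) : Instr → Prop
  | .const d _ | .add d _ _ | .sub d _ _ | .mul d _ _ | .load d _ => L ≤ d
  | .store _ _ => True

theorem Frame.apply {L : ℕ} {s s' : State} {i : Instr} (h : Frame L s s') (hi : i.Above L) :
    Frame L s (i.apply s') := by
  cases i <;> first | exact h.update hi | exact h

theorem Runs.block {w L : ℕ} {l : List Instr} {s₀ s : State} {Q : State → Prop}
    (hF : Frame L s₀ s) (hl : ∀ i ∈ l, i.Above L) (hf : Fits w l s)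
    (hQ : Q (l.foldl Instr.apply s)) :
    Runs w l.length (block l) s fun s' => Frame L s₀ s' ∧ Q s' := by
  induction l generalizing s with
  | nil => exact Runs.skip ⟨hF, hQ⟩
  | cons i l ih =>
    rw [List.length_cons, Nat.add_comm]
    exact Runs.seq (R := fun s' => s' = i.apply s) ⟨1, _, .instr i s hf.1, le_rfl, rfl⟩
      (fun s' h => h ▸ ih (hF.apply (hl i (by simp))) (fun i' h' => hl i' (by simp [h'])) hf.2 hQ)

/-- `for i in 0, …, reg N - 1`; register `2` has to hold `1`. -/
def forLoop (i N : ℕ) (body : Prog) : Prog :=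
  .seq (.instr (.const i 0)) (.while (.lt i N) (.seq body (.instr (.add i i 2))))

/-- Each round costs the body plus one test and one increment; the final `+ 2` pays for the
initialization and the failing test. The invariant must not depend on the counter register (`hJ`),
because the loop itself writes it between two rounds. -/
theorem Runs.forLoop {w T L i r N : ℕ} {body : Prog} {s : State} (J : ℕ → State → Prop)
    (hi : L ≤ i) (hrL : r < L) (hL : 2 < L) (hr : s.reg r = N) (h2 : s.reg 2 = 1)
    (hw : N < 2 ^ w)
    (hJ : ∀ k s v, J k s → J k ⟨update s.reg i v, s.mem⟩) (h0 : J 0 s)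
    (hstep : ∀ k s', k < N → Frame L s s' → s'.reg i = k → J k s' →
      Runs w T body s' fun s'' => Frame L s s'' ∧ s''.reg i = k ∧ J (k + 1) s'') :
    Runs w (N * (T + 2) + 2) (forLoop i r body) s fun s' => Frame L s s' ∧ J N s' := by
  have key : ∀ d k s', k + d = N → Frame L s s' → s'.reg i = k → J k s' →
      Runs w (d * (T + 2) + 1) (.while (.lt i r) (.seq body (.instr (.add i i 2)))) s'
        fun s' => Frame L s s' ∧ J N s' := by
    intro d
    induction d with
    | zero =>
      intro k s' hk hF hik hJk
      have : k = N := by omega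
      subst this
      refine ⟨1, s', .whileFalse ?_, by omega, hF, hJk⟩
      simp [Test.Holds, hF r hrL, hr, hik]
    | succ d ih =>
      intro k s' hk hF hik hJk
      obtain ⟨t, s₁, he, ht, hF₁, hi₁, hJ₁⟩ := hstep k s' (by omega) hF hik hJk
      have hv : (Instr.add i i 2).value s₁ = k + 1 := by
        simp [Instr.value, hi₁, hF₁ 2 hL, h2]
      obtain ⟨t', s₂, he', ht', hQ⟩ := ih (k + 1) ((Instr.add i i 2).apply s₁) (by omega)
        (hF₁.update hi) (by simp [Instr.apply, hv]) (hJ _ _ _ hJ₁)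
      refine ⟨1 + (t + 1) + t', s₂, .whileTrue ?_ (.seq he (.instr _ _ ?_)) he', ?_, hQ⟩
      · simp only [Test.Holds, hF r hrL, hr, hik]; omega
      · rw [hv]; omega
      · rw [Nat.add_mul]; omega
  have h := Runs.seq (w := w) (s := s) (R := fun s' => s' = ⟨update s.reg i 0, s.mem⟩)
    ⟨1, _, .instr (.const i 0) _ (by simp [Instr.value]), le_rfl, rfl⟩
    (fun s' h => h ▸ key N 0 _ (by omega) ((Frame.refl L s).update hi) (by simp) (hJ _ _ _ h0))
  exact h.mono (by omega) fun _ h => h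

/-! ### The program -/

/-- Cell `u * n + v` of the array at `reg 3` becomes `1` if some row contains `u` and `v`. -/
def adjacencyProg : Prog :=
  forLoop 10 0 <| forLoop 11 0 <|
    .seq (block [.const 12 0]) <| .seq
      (forLoop 13 1 <| .seq
        (block [.mul 14 13 0, .add 15 14 10, .load 15 15, .add 14 14 11, .load 14 14, .mul 14 14 15])
        (.ite (.eq 14 2) (block [.const 12 1]) .skip))
      (block [.mul 14 10 0, .add 14 14 11, .add 14 14 3, .store 14 12])

/-- Inserts the rows of the incidence matrix into the binary trie at `reg 5`, which has the root `1`
and stores the children of the node `c` in its cells `2 * c` and `2 * c + 1`. -/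
def trieProg : Prog :=
  .seq (block [.const 10 1]) <| forLoop 7 1 <| .seq (block [.const 9 1]) <| forLoop 8 0 <| .seq
    (block [.mul 12 7 0, .add 12 12 8, .load 12 12, .add 12 12 9, .add 12 12 9, .add 12 12 5,
      .load 9 12])
    (.ite (.eq 9 6) (block [.add 10 10 2, .store 12 10, .add 9 10 6]) .skip)

/-- Writes the set of all members of row `reg 10` that are adjacent to the vertex `reg 11`, and of
this vertex itself, into the array at `reg 4`. -/
def seedProg : Prog :=
  .seq
    (forLoop 13 0 <| block [.mul 14 10 0, .add 14 14 13, .load 14 14, .mul 15 11 0, .add 15 15 13,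
      .add 15 15 3, .load 15 15, .mul 14 14 15, .add 15 4 13, .store 15 14])
    (block [.add 15 4 11, .store 15 2])

/-- Extends the clique in the array at `reg 4` greedily to a maximal one. -/
def greedyProg : Prog :=
  forLoop 13 0 <| .seq (block [.const 14 1]) <| .seq
    (forLoop 15 0 <| .seq
      (block [.add 16 4 15, .load 16 16, .mul 17 13 0, .add 17 17 15, .add 17 17 3, .load 17 17])
      (.ite (.lt 17 16) (block [.const 14 0]) .skip))
    (.ite (.eq 14 2) (block [.add 15 4 13, .store 15 2]) .skip)

/-- Looks up the array at `reg 4` in the trie. -/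
def lookupProg : Prog :=
  .seq (block [.const 14 1]) <| forLoop 13 0 <|
    block [.add 15 4 13, .load 15 15, .add 15 15 14, .add 15 15 14, .add 15 15 5, .load 14 15]

/-- Sets `reg 12` to `0` if the maximal clique obtained from row `reg 10` and vertex `reg 11` is not
a row. -/
def checkProg : Prog :=
  .seq (block [.mul 13 11 0, .add 13 13 11, .add 13 13 3, .load 13 13]) <|
    .ite (.eq 13 2)
      (.seq seedProg <| .seq greedyProg <| .seq lookupProg <|
        .ite (.eq 14 6) (block [.const 12 0]) .skip)
      .skip

/-- Runs the check for all rows and vertices until one fails. -/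
def searchProg : Prog :=
  .seq (block [.const 12 1]) <| forLoop 10 1 <| forLoop 11 0 <| .ite (.eq 12 2) checkProg .skip

/-- The recognition of conformal hypergraphs. -/
def conformalProg : Prog :=
  .seq (block [.const 2 1, .mul 3 1 0]) <| .ite (.lt 6 3)
    (.seq (block [.mul 4 0 0, .add 4 3 4, .add 5 4 0]) <| .seq adjacencyProg <| .seq trieProg <|
      .seq searchProg <| block [.add 0 12 6, .add 1 4 6])
    (block [.const 0 1])

/-! ### Row-major indexing and the adjacency matrix -/

theorem index_lt {m n j i : ℕ} (hj : j < m) (hi : i < n) : j * n + i < m * n :=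
  calc j * n + i < (j + 1) * n := by rw [Nat.add_mul]; omega
    _ ≤ m * n := Nat.mul_le_mul_right n hj

theorem index_inj {n j i j' i' : ℕ} (hi : i < n) (hi' : i' < n) (h : j * n + i = j' * n + i') :
    j = j' ∧ i = i' := by
  rcases lt_trichotomy j j' with hj | hj | hj
  · have := index_lt hj hi; omega
  · subst hj; exact ⟨rfl, by omega⟩
  · have := index_lt hj hi'; omega

/-- The vertices `u` and `v` are in a common row of the matrix `inc` with `m` rows. -/
def Adj (m : ℕ) (inc : ℕ → ℕ → ℕ) (u v : ℕ) : Prop := ∃ j < m, inc j u = 1 ∧ inc j v = 1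

theorem Adj.symm {m : ℕ} {inc : ℕ → ℕ → ℕ} {u v : ℕ} (h : Adj m inc u v) : Adj m inc v u :=
  let ⟨j, hj, hu, hv⟩ := h
  ⟨j, hj, hv, hu⟩

theorem Adj.refl_left {m : ℕ} {inc : ℕ → ℕ → ℕ} {u v : ℕ} (h : Adj m inc u v) : Adj m inc u u :=
  let ⟨j, hj, hu, _⟩ := h
  ⟨j, hj, hu, hu⟩

open Classical in
/-- The entries of the adjacency matrix. -/
noncomputable def adjBit (m : ℕ) (inc : ℕ → ℕ → ℕ) (u v : ℕ) : ℕ := if Adj m inc u v then 1 else 0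

theorem adjBit_le (m : ℕ) (inc : ℕ → ℕ → ℕ) (u v : ℕ) : adjBit m inc u v ≤ 1 := by
  unfold adjBit
  split_ifs <;> omega

theorem adjBit_eq_one {m : ℕ} {inc : ℕ → ℕ → ℕ} {u v : ℕ} :
    adjBit m inc u v = 1 ↔ Adj m inc u v := by
  simp [adjBit]

/-- The registers `0, …, 6` hold the numbers of vertices and edges, the constants `1` and `0`, and
the addresses of the adjacency matrix, the vertex array and the trie; the first `m * n` cells hold
the `0`-`1` matrix `inc`, and words are long enough. -/
structure Ctx (w n m : ℕ) (inc : ℕ → ℕ → ℕ) (s : State) : Prop where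
  r0 : s.reg 0 = n
  r1 : s.reg 1 = m
  r2 : s.reg 2 = 1
  r3 : s.reg 3 = m * n
  r4 : s.reg 4 = m * n + n * n
  r5 : s.reg 5 = m * n + n * n + n
  r6 : s.reg 6 = 0
  inc_le : ∀ j i, inc j i ≤ 1
  row : ∀ j < m, ∀ i < n, s.mem (j * n + i) = inc j i
  word : 4 * (m * n) + n * n + n + m + 8 ≤ 2 ^ w

theorem Ctx.of_frame {w n m : ℕ} {inc : ℕ → ℕ → ℕ} {s s' : State} (c : Ctx w n m inc s)
    (hF : Frame 7 s s') (hm : ∀ a < m * n, s'.mem a = s.mem a) : Ctx w n m inc s' where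
  r0 := (hF 0 (by omega)).trans c.r0
  r1 := (hF 1 (by omega)).trans c.r1
  r2 := (hF 2 (by omega)).trans c.r2
  r3 := (hF 3 (by omega)).trans c.r3
  r4 := (hF 4 (by omega)).trans c.r4
  r5 := (hF 5 (by omega)).trans c.r5
  r6 := (hF 6 (by omega)).trans c.r6
  inc_le := c.inc_le
  row := fun j hj i hi => (hm _ (index_lt hj hi)).trans (c.row j hj i hi)
  word := c.word

theorem Ctx.word_ne_zero {w n m : ℕ} {inc : ℕ → ℕ → ℕ} {s : State} (c : Ctx w n m inc s) :
    w ≠ 0 := by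
  rintro rfl
  have := c.word
  omega

theorem runs_adjacencyProg {w n m : ℕ} {inc : ℕ → ℕ → ℕ} {s : State} (c : Ctx w n m inc s) :
    Runs w (n * (n * (m * 10 + 9) + 4) + 2) adjacencyProg s fun s' => Frame 7 s s' ∧
      (∀ a, a < m * n ∨ m * n + n * n ≤ a → s'.mem a = s.mem a) ∧
      ∀ u < n, ∀ v < n, s'.mem (m * n + (u * n + v)) = adjBit m inc u v := by
  have hw := c.word
  -- The first `b` entries in row-major order are done. One invariant then serves both loops, with
  -- `b = k * n` outside and `b = k * n + l` inside.
  let D (b : ℕ) (s' : State) : Prop :=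
    (∀ a, a < m * n ∨ m * n + n * n ≤ a → s'.mem a = s.mem a) ∧
      ∀ u < n, ∀ v < n, u * n + v < b →
        s'.mem (m * n + (u * n + v)) = adjBit m inc u v
  refine (Runs.forLoop (L := 10) (T := n * (m * 10 + 9) + 2) (fun k => D (k * n)) (by norm_num)
    (by norm_num) (by norm_num) c.r0 c.r2 (by omega) (fun _ _ _ h => h) ?_ ?_).mono le_rfl ?_
  · exact ⟨fun _ _ => rfl, fun u _ v _ h => by omega⟩
  · intro k s₁ hk hF₁ hk₁ hD₁
    have c₁ : Ctx w n m inc s₁ := c.of_frame (fun r hr => hF₁ r (by omega))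
      fun a ha => hD₁.1 a (Or.inl ha)
    refine (Runs.forLoop (L := 11) (T := m * 10 + 7) (fun l => D (k * n + l)) (by norm_num)
      (by norm_num) (by norm_num) c₁.r0 c₁.r2 (by omega) (fun _ _ _ h => h) hD₁ ?_).mono le_rfl ?_
    · intro l s₂ hl hF₂ hl₂ hD₂
      have c₂ : Ctx w n m inc s₂ := c₁.of_frame (fun r hr => hF₂ r (by omega))
        fun a ha => by rw [hD₂.1 a (Or.inl ha), hD₁.1 a (Or.inl ha)]
      have hk₂ : s₂.reg 10 = k := by rw [hF₂ 10 (by omega), hk₁]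
      have h₁ : Runs w 1 (block [.const 12 0]) s₂ fun s₃ =>
          Frame 12 s₂ s₃ ∧ s₃.mem = s₂.mem ∧ s₃.reg 12 = 0 :=
        Runs.block (Frame.refl _ _) (by simp [Instr.Above]) (by simp [Fits, Instr.value])
          (by simp [Instr.apply, Instr.value])
      refine (h₁.seq (T₂ := (m * 10 + 2) + 4) fun s₃ h₃ => ?_).mono (by omega) fun _ h => h
      obtain ⟨hF₃, hm₃, h12⟩ := h₃
      have c₃ : Ctx w n m inc s₃ := c₂.of_frame (fun r hr => hF₃ r (by omega)) fun a _ => by rw [hm₃]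
      refine Runs.seq (R := fun s' => Frame 12 s₃ s' ∧ s'.mem = s₃.mem ∧
        s'.reg 12 = adjBit m inc k l) ?_ ?_
      -- After `b` rounds the flag is the adjacency bit of the matrix truncated to its first `b`
      -- rows.
      · refine Runs.forLoop (L := 12) (T := 8) (fun b s' => s'.mem = s₃.mem ∧
          s'.reg 12 = adjBit b inc k l) (by norm_num)
          (by norm_num) (by norm_num) c₃.r1 c₃.r2 (by omega) (fun b s' v h => by simpa using h)
          ⟨rfl, by simp [h12, adjBit, Adj]⟩ ?_
        intro j s₄ hj hF₄ hj₄ ⟨hm₄, h12₄⟩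
        have e0 : s₄.reg 0 = n := by rw [hF₄ 0 (by omega), c₃.r0]
        have e10 : s₄.reg 10 = k := by rw [hF₄ 10 (by omega), hF₃ 10 (by omega), hk₂]
        have e11 : s₄.reg 11 = l := by rw [hF₄ 11 (by omega), hF₃ 11 (by omega), hl₂]
        have m1 : s₃.mem (j * n + k) = inc j k := by rw [c₃.row j hj k hk]
        have m2 : s₃.mem (j * n + l) = inc j l := by rw [c₃.row j hj l hl]
        have i1 := index_lt hj hk
        have i2 := index_lt hj hl
        have b1 := c.inc_le j k
        have b2 := c.inc_le j l
        have b3 : inc j l * inc j k ≤ 1 := Nat.mul_le_mul b2 b1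
        have h₅ : Runs w 6 (block [.mul 14 13 0, .add 15 14 10, .load 15 15, .add 14 14 11,
            .load 14 14, .mul 14 14 15]) s₄ fun s' => Frame 12 s₃ s' ∧ s'.reg 13 = j ∧
              s'.mem = s₃.mem ∧ s'.reg 12 = s₄.reg 12 ∧ s'.reg 14 = inc j l * inc j k := by
          refine Runs.block hF₄ (by simp [Instr.Above]) ?_ ?_
          · simp [Fits, Instr.value, Instr.apply, e0, e10, e11, hj₄, m1, m2, hm₄]
            omega
          · simp [Instr.value, Instr.apply, e0, e10, e11, hj₄, m1, m2, hm₄]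
        refine h₅.seq (T₂ := 1 + 1) fun s₅ ⟨hF₅, h13, hm₅, h12₅, h14⟩ => Runs.ite ?_ ?_
        · intro hb
          have h1 : inc j k = 1 ∧ inc j l = 1 := by
            have e2 : s₅.reg 2 = 1 := by rw [hF₅ 2 (by omega), c₃.r2]
            simp only [Test.Holds, h14, e2] at hb
            exact (mul_eq_one.1 hb).symm
          refine (Runs.block hF₅ (by simp [Instr.Above]) 
            (by simp [Fits, Instr.value, c.word_ne_zero]) ?_)
          have : Adj (j + 1) inc k l := ⟨j, by omega, h1⟩
          simp [Instr.apply, Instr.value, h13, hm₅, adjBit, this]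
        · intro hb
          have e2 : s₅.reg 2 = 1 := by rw [hF₅ 2 (by omega), c₃.r2]
          simp only [Test.Holds, h14, e2] at hb
          refine (Runs.skip ⟨hF₅, h13, hm₅, ?_⟩).mono (by omega) fun _ h => h
          rw [h12₅, h12₄]
          unfold adjBit
          congr 1
          simp only [Adj, Nat.lt_succ_iff_lt_or_eq, eq_iff_iff]
          refine ⟨fun ⟨j', h, h'⟩ => ⟨j', Or.inl h, h'⟩, fun ⟨j', h, h'⟩ => ?_⟩
          rcases h with h | rfl
          · exact ⟨j', h, h'⟩
          · exact absurd (by simp [h'.1, h'.2]) hb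
      · intro s₄ ⟨hF₄, hm₄, h12₄⟩
        have e0 : s₄.reg 0 = n := by rw [hF₄ 0 (by omega), c₃.r0]
        have e3 : s₄.reg 3 = m * n := by rw [hF₄ 3 (by omega), c₃.r3]
        have e10 : s₄.reg 10 = k := by rw [hF₄ 10 (by omega), hF₃ 10 (by omega), hk₂]
        have e11 : s₄.reg 11 = l := by rw [hF₄ 11 (by omega), hF₃ 11 (by omega), hl₂]
        have i1 := index_lt hk hl
        have hF : Frame 11 s₁ s₄ :=
          hF₂.trans (hF₃.trans hF₄ le_rfl) (by omega)
        refine Runs.block hF (by simp [Instr.Above]) ?_ ⟨?_, ?_, ?_⟩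
        · simp [Fits, Instr.value, Instr.apply, e0, e3, e10, e11, h12₄]
          refine ⟨by omega, by omega, by omega, ?_⟩
          have := adjBit_le m inc k l
          omega
        · simp [Instr.apply, e11]
        · intro a ha
          simp [Instr.apply, Instr.value, e0, e3, e10, e11, hm₄, hm₃]
          rw [update_of_ne (by omega), hD₂.1 a ha]
        · intro u hu v hv huv
          simp [Instr.apply, Instr.value, e0, e3, e10, e11, hm₄, hm₃]
          rcases (by omega : u * n + v < k * n + l ∨ u * n + v = k * n + l) with h | h
          · rw [update_of_ne (by omega), hD₂.2 u hu v hv h]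
          · obtain ⟨rfl, rfl⟩ := index_inj hv hl h
            rw [Nat.add_comm (m * n), update_self, h12₄]
    · rintro s' ⟨hF', hD'⟩
      exact ⟨hF₁.trans hF' (by omega), by rw [hF' 10 (by omega), hk₁],
        by rwa [Nat.add_mul, Nat.one_mul]⟩
  · rintro s' ⟨hF', hD'⟩
    exact ⟨fun r hr => hF' r (by omega), hD'.1, fun u hu v hv => hD'.2 u hu v hv (index_lt hu hv)⟩

/-! ### Tries -/

/-- The node that is reached from the root along the first letters of `f`. -/
def walk (ch : ℕ → ℕ → ℕ) (f : ℕ → ℕ) : ℕ → ℕ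
  | 0 => 1
  | k + 1 => ch (walk ch f k) (f k)

/-- The child function `ch` describes a trie with the nodes `1, …, N`, the root `1` and the null node
`0`. A node `c` represents the first `dep c` letters of the row `row c` of the matrix `inc`. -/
structure IsTrie (m : ℕ) (inc ch : ℕ → ℕ → ℕ) (N : ℕ) (dep row : ℕ → ℕ) : Prop where
  one_le : 1 ≤ N
  le : ∀ c, ∀ b ≤ 1, ch c b ≤ N
  null : ∀ b ≤ 1, ch 0 b = 0
  fresh : ∀ c, ∀ b ≤ 1, N < c → ch c b = 0
  dep_one : dep 1 = 0
  child : ∀ c, ∀ b ≤ 1, ch c b ≠ 0 → dep (ch c b) = dep c + 1 ∧ row (ch c b) < m ∧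
    (∀ i < dep c, inc (row (ch c b)) i = inc (row c) i) ∧ inc (row (ch c b)) (dep c) = b

variable {m N : ℕ} {inc ch ch' : ℕ → ℕ → ℕ} {dep row f : ℕ → ℕ}

theorem IsTrie.walk_le (h : IsTrie m inc ch N dep row) (hf : ∀ i, f i ≤ 1) (k : ℕ) :
    walk ch f k ≤ N := by
  cases k with
  | zero => exact h.one_le
  | succ k => exact h.le _ _ (hf k)

theorem IsTrie.walk_ne_zero (h : IsTrie m inc ch N dep row) (hf : ∀ i, f i ≤ 1) {k : ℕ}
    (hk : walk ch f (k + 1) ≠ 0) : walk ch f k ≠ 0 := fun h0 =>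
  hk (by rw [walk, h0, h.null _ (hf k)])

/-- The root has no meaningful `row`, as it exists before any insertion; hence the restriction `0 <
k`. -/
theorem IsTrie.walk_sound (h : IsTrie m inc ch N dep row) (hf : ∀ i, f i ≤ 1) {k : ℕ}
    (hk : walk ch f k ≠ 0) : dep (walk ch f k) = k ∧ (0 < k → row (walk ch f k) < m) ∧
      ∀ i < k, inc (row (walk ch f k)) i = f i := by
  induction k with
  | zero => exact ⟨h.dep_one, by omega, by omega⟩
  | succ k ih =>
    obtain ⟨hd, -, hi⟩ := ih (h.walk_ne_zero hf hk)
    obtain ⟨h1, h2, h3, h4⟩ := h.child _ _ (hf k) hk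
    rw [hd] at h1 h3 h4
    refine ⟨h1, fun _ => h2, fun i hik => ?_⟩
    rcases Nat.lt_succ_iff_lt_or_eq.1 hik with hik | rfl
    · exact (h3 i hik).trans (hi i hik)
    · exact h4

/-- Insertion only fills empty child slots, so rows found in the old trie are still found in the new
one. -/
theorem IsTrie.walk_eq (h : IsTrie m inc ch N dep row) (hf : ∀ i, f i ≤ 1)
    (hch : ∀ c, ∀ b ≤ 1, ch c b ≠ 0 → ch' c b = ch c b) {k : ℕ} (hk : walk ch f k ≠ 0) :
    walk ch' f k = walk ch f k := by
  induction k with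
  | zero => rfl
  | succ k ih =>
    rw [walk, ih (h.walk_ne_zero hf hk), hch _ _ (hf k) hk, walk]

theorem IsTrie.insert (h : IsTrie m inc ch N dep row) {c b j : ℕ} (hc : c ≠ 0) (hcN : c ≤ N)
    (hb : b ≤ 1) (hj : j < m) (h0 : ch c b = 0) (hrow : ∀ i < dep c, inc (row c) i = inc j i)
    (hlast : inc j (dep c) = b)
    (hch : ∀ c', ∀ b' ≤ 1, ch' c' b' = if c' = c ∧ b' = b then N + 1 else ch c' b') :
    IsTrie m inc ch' (N + 1) (update dep (N + 1) (dep c + 1)) (update row (N + 1) j) where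
  one_le := by omega
  le c' b' hb' := by
    have := h.le c' b' hb'
    rw [hch c' b' hb']
    split_ifs <;> omega
  null b' hb' := by
    rw [hch 0 b' hb', if_neg (fun h => hc h.1.symm), h.null b' hb']
  fresh c' b' hb' hc' := by
    rw [hch c' b' hb', if_neg (by omega), h.fresh c' b' hb' (by omega)]
  dep_one := by
    have := h.one_le
    rw [update_of_ne (by omega), h.dep_one]
  child c' b' hb' hne := by
    rw [hch c' b' hb'] at hne ⊢
    split_ifs at hne ⊢ with hcb
    · obtain ⟨rfl, rfl⟩ := hcb
      have hn : c' ≠ N + 1 := by omega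
      simp only [update_self, update_of_ne hn]
      exact ⟨trivial, hj, fun i hi => (hrow i hi).symm, hlast⟩
    · have h1 := h.le c' b' hb'
      -- Nodes beyond `N` have no children in the old trie, so neither end of an old link is the new
      -- node `N + 1`, and the updates of `dep` and `row` do not affect it.
      have h2 : c' ≤ N := by
        by_contra hlt
        exact hne (h.fresh c' b' hb' (by omega))
      have hn : c' ≠ N + 1 := by omega
      have hn' : ch c' b' ≠ N + 1 := by omega
      simp only [update_of_ne hn, update_of_ne hn']
      exact h.child c' b' hb' hne

/-- The child function of a trie that is stored in the memory `mem` from the address `B` on. -/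
def child (B : ℕ) (mem : ℕ → ℕ) (c b : ℕ) : ℕ := mem (B + (2 * c + b))

theorem child_congr {B : ℕ} {mem mem' : ℕ → ℕ} (h : ∀ a, B ≤ a → mem' a = mem a) :
    child B mem' = child B mem := by
  funext c b
  exact h _ (by omega)

/-- All rows of `inc` have been inserted into the trie at the address `B`. -/
def TrieOf (n m B : ℕ) (inc : ℕ → ℕ → ℕ) (mem : ℕ → ℕ) : Prop :=
  (∃ N dep row, N ≤ 1 + m * n ∧ IsTrie m inc (child B mem) N dep row) ∧
    ∀ j < m, walk (child B mem) (inc j) n ≠ 0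

theorem runs_trieProg {w n m : ℕ} {inc : ℕ → ℕ → ℕ} {s : State} (c : Ctx w n m inc s)
    (hz : ∀ a, m * n + n * n + n ≤ a → s.mem a = 0) :
    Runs w (m * (n * 13 + 5) + 3) trieProg s fun s' => Frame 7 s s' ∧
      (∀ a < m * n + n * n + n, s'.mem a = s.mem a) ∧ TrieOf n m (m * n + n * n + n) inc s'.mem := by
  have hw := c.word
  have hw0 := c.word_ne_zero
  set B := m * n + n * n + n with hB
  let D (j b : ℕ) (s' : State) : Prop :=
    (∀ a < B, s'.mem a = s.mem a) ∧ s'.reg 10 ≤ 1 + b ∧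
      (∀ j' < j, walk (child B s'.mem) (inc j') n ≠ 0) ∧
      ∃ dep row, IsTrie m inc (child B s'.mem) (s'.reg 10) dep row
  have h₁ : Runs w 1 (block [.const 10 1]) s fun s' => Frame 7 s s' ∧ s'.mem = s.mem ∧
      s'.reg 10 = 1 :=
    Runs.block (Frame.refl _ _) (by simp [Instr.Above]) (by simp [Fits, Instr.value, hw0])
      (by simp [Instr.apply, Instr.value])
  refine (h₁.seq (T₂ := m * (n * 13 + 5) + 2) fun s₀ h => ?_).mono (by omega) fun _ h => h
  obtain ⟨hF₀, hm₀, h10⟩ := h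
  have c₀ : Ctx w n m inc s₀ := c.of_frame hF₀ fun a _ => by rw [hm₀]
  have hz₀ : ∀ c b, child B s₀.mem c b = 0 := fun c b => by
    rw [child, hm₀, hz _ (by omega)]
  refine (Runs.forLoop (L := 7) (T := n * 13 + 3) (fun j => D j (j * n)) (by norm_num)
    (by norm_num) (by norm_num) c₀.r1 c₀.r2 (by omega)
    (fun _ _ _ h => by simpa [D] using h) ?_ ?_).mono le_rfl ?_
  -- Zeroed memory is the trie with only a root. The conditions on children are vacuous, so zero
  -- functions serve as `dep` and `row`.
  · refine ⟨fun a _ => by rw [hm₀], by omega, fun _ h => absurd h (by omega), fun _ => 0, fun _ => 0, ?_⟩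
    rw [h10]
    constructor <;> simp [hz₀]
  · intro j s₁ hj hF₁ hj₁ hD₁
    have h₂ : Runs w 1 (block [.const 9 1]) s₁ fun s' => Frame 8 s₁ s' ∧ s'.mem = s₁.mem ∧
        s'.reg 9 = 1 ∧ s'.reg 10 = s₁.reg 10 :=
      Runs.block (Frame.refl _ _) (by simp [Instr.Above]) (by simp [Fits, Instr.value, hw0])
        (by simp [Instr.apply, Instr.value])
    refine (h₂.seq (T₂ := n * 13 + 2) fun s₂ h => ?_).mono (by omega) fun _ h => h
    obtain ⟨hF₂, hm₂, h9, h10₂⟩ := h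
    have hD₂ : D j (j * n) s₂ := by
      simpa only [D, hm₂, h10₂] using hD₁
    have c₂ : Ctx w n m inc s₂ := c.of_frame
      ((hF₀.trans hF₁ (by omega)).trans hF₂ (by omega)) fun a ha => hD₂.1 a (by omega)
    refine (Runs.forLoop (L := 8) (T := 11) (fun i s' => D j (j * n + i) s' ∧
      s'.reg 9 = walk (child B s'.mem) (inc j) i ∧ s'.reg 9 ≠ 0) (by norm_num)
      (by norm_num) (by norm_num) c₂.r0 c₂.r2 (by omega)
      (fun _ _ _ h => by simpa [D] using h) ⟨hD₂, h9, by omega⟩ ?_).mono le_rfl ?_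
    · intro i s₃ hi hF₃ hi₃ ⟨hD₃, h9₃, h9n⟩
      obtain ⟨hm₃, h10₃, hw₃, dep, row, hT⟩ := hD₃
      have e0 : s₃.reg 0 = n := by rw [hF₃ 0 (by omega), c₂.r0]
      have e5 : s₃.reg 5 = B := by rw [hF₃ 5 (by omega), c₂.r5]
      have e7 : s₃.reg 7 = j := by rw [hF₃ 7 (by omega), hF₂ 7 (by omega), hj₁]
      have i1 := index_lt hj hi
      have m1 : s₃.mem (j * n + i) = inc j i := by rw [hm₃ _ (by omega), c.row j hj i hi]
      have b1 := c.inc_le j i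
      have hle := hT.walk_le (c.inc_le j) i
      rw [← h9₃] at hle
      have hadr : inc j i + s₃.reg 9 + s₃.reg 9 + B = B + (2 * s₃.reg 9 + inc j i) := by ring
      have hval : child B s₃.mem (s₃.reg 9) (inc j i) ≤ s₃.reg 10 := hT.le _ _ b1
      have h₄ : Runs w 7 (block [.mul 12 7 0, .add 12 12 8, .load 12 12, .add 12 12 9,
          .add 12 12 9, .add 12 12 5, .load 9 12]) s₃ fun s' => Frame 8 s₂ s' ∧ s'.reg 8 = i ∧
            s'.mem = s₃.mem ∧ s'.reg 9 = child B s₃.mem (s₃.reg 9) (inc j i) ∧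
            s'.reg 10 = s₃.reg 10 ∧ s'.reg 12 = B + (2 * s₃.reg 9 + inc j i) := by
        refine Runs.block hF₃ (by simp [Instr.Above]) ?_ ?_
        · unfold child at hval
          simp [Fits, Instr.value, Instr.apply, e0, e5, e7, hi₃, m1, hadr]
          omega
        · simp [Instr.value, Instr.apply, e0, e5, e7, hi₃, m1, hadr, child]
      refine h₄.seq (T₂ := 1 + 3) fun s₄ ⟨hF₄, h8₄, hm₄, h9₄, h10₄, h12₄⟩ => Runs.ite ?_ ?_
      · intro hb
        have e6 : s₄.reg 6 = 0 := by rw [hF₄ 6 (by omega), c₂.r6]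
        have e2 : s₄.reg 2 = 1 := by rw [hF₄ 2 (by omega), c₂.r2]
        simp only [Test.Holds, h9₄, e6] at hb
        refine Runs.block hF₄ (by simp [Instr.Above]) ?_ ?_
        · simp [Fits, Instr.value, Instr.apply, e2, e6]
          omega
        -- For bits `b` the offset `2 * c + b` determines `c` and `b`, so the store changes a single
        -- child slot.
        have hch : ∀ (c b : ℕ), b ≤ 1 →
            child B (update s₄.mem (B + (2 * s₃.reg 9 + inc j i)) (s₃.reg 10 + 1)) c b =
              if c = s₃.reg 9 ∧ b = inc j i then s₃.reg 10 + 1 else child B s₃.mem c b := by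
          intro c b hb
          simp only [child, update_apply, hm₄]
          congr 1
          simp only [eq_iff_iff]
          omega
        have hext : ∀ (c b : ℕ), b ≤ 1 → child B s₃.mem c b ≠ 0 →
            child B (update s₄.mem (B + (2 * s₃.reg 9 + inc j i)) (s₃.reg 10 + 1)) c b =
              child B s₃.mem c b := by
          intro c' b' hb' hne
          rw [hch c' b' hb', if_neg]
          rintro ⟨rfl, rfl⟩
          exact hne hb
        have hdep := hT.walk_sound (c.inc_le j) (h9₃ ▸ h9n)
        rw [← h9₃] at hdep
        have hT' := hT.insert h9n hle b1 hj hb (hdep.1 ▸ hdep.2.2) (by rw [hdep.1]) hch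
        simp [Instr.value, Instr.apply, e2, e6, h8₄, h10₄, h12₄]
        refine ⟨⟨fun a ha => ?_, ?_, fun j' hj' => ?_, _, _, hT'⟩, ?_⟩
        · dsimp only
          rw [update_of_ne (by omega), hm₄, hm₃ a ha]
        · dsimp only
          rw [update_of_ne (by norm_num), update_self]
          omega
        · have h := hw₃ j' hj'
          rwa [hT.walk_eq (c.inc_le j') hext h]
        · rw [walk, hT.walk_eq (c.inc_le j) hext (h9₃ ▸ h9n), ← h9₃, hch _ _ b1,
            if_pos ⟨rfl, rfl⟩]
      · intro hb
        have e6 : s₄.reg 6 = 0 := by rw [hF₄ 6 (by omega), c₂.r6]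
        simp only [Test.Holds] at hb
        refine (Runs.skip ⟨hF₄, h8₄, ?_⟩).mono (by omega) fun _ h => h
        refine ⟨⟨by rwa [hm₄], by omega, by rwa [hm₄], dep, row, by rwa [hm₄, h10₄]⟩, ?_, ?_⟩
        · rw [h9₄, hm₄, walk, ← h9₃]
        · rw [h9₄]
          exact fun h => hb (by rw [h9₄, e6, h])
    · rintro s₃ ⟨hF₃, ⟨hm₃, h10₃, hw₃, hT⟩, h9₃, h9n⟩
      refine ⟨(hF₁.trans hF₂ (by omega)).trans hF₃ (by omega),
        by rw [hF₃ 7 (by omega), hF₂ 7 (by omega), hj₁], hm₃,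
        by rwa [Nat.add_mul, Nat.one_mul], fun j' hj' => ?_, hT⟩
      rcases Nat.lt_succ_iff_lt_or_eq.1 hj' with hj' | rfl
      · exact hw₃ j' hj'
      · rwa [← h9₃]
  · rintro s' ⟨hF', hm', h10', hw', dep, row, hT⟩
    exact ⟨hF₀.trans hF' le_rfl, hm', ⟨_, dep, row, h10', hT⟩, hw'⟩

/-! ### The search for a counterexample -/

theorem walk_congr {ch : ℕ → ℕ → ℕ} {f g : ℕ → ℕ} {k : ℕ} (h : ∀ i < k, f i = g i) :
    walk ch f k = walk ch g k := by
  induction k with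
  | zero => rfl
  | succ k ih => rw [walk, walk, ih fun i hi => h i (by omega), h k (by omega)]

/-- For `n = 0` the walk ends at the root, which is nonzero even when there are no rows; this is why
`hn` is needed. -/
theorem TrieOf.walk_ne_zero_iff {n m B : ℕ} {inc : ℕ → ℕ → ℕ} {mem f : ℕ → ℕ}
    (h : TrieOf n m B inc mem) (hn : 0 < n) (hf : ∀ i, f i ≤ 1) :
    walk (child B mem) f n ≠ 0 ↔ ∃ j < m, ∀ i < n, inc j i = f i := by
  obtain ⟨⟨N, dep, row, -, hT⟩, hw⟩ := h
  constructor
  · intro h0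
    obtain ⟨-, h1, h2⟩ := hT.walk_sound hf h0
    exact ⟨_, h1 hn, h2⟩
  · rintro ⟨j, hj, hji⟩
    rw [← walk_congr hji]
    exact hw j hj

/-- The cells from `V` on hold the characteristic vector of the set `M` of numbers below `n`. -/
structure Stores (n V : ℕ) (mem : ℕ → ℕ) (M : Set ℕ) : Prop where
  lt : ∀ i ∈ M, i < n
  le : ∀ i < n, mem (V + i) ≤ 1
  mem_iff : ∀ i < n, mem (V + i) = 1 ↔ i ∈ M

/-- `M` is a clique of the graph `Adj m inc`. -/
def Clique (m : ℕ) (inc : ℕ → ℕ → ℕ) (M : Set ℕ) : Prop := ∀ u ∈ M, ∀ v ∈ M, Adj m inc u v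

/-- The members of row `j` that are adjacent to `v`, and `v` itself. -/
def seed (n m : ℕ) (inc : ℕ → ℕ → ℕ) (j v : ℕ) : Set ℕ :=
  {i | i < n ∧ (inc j i = 1 ∧ Adj m inc v i ∨ i = v)}

/-- Members of row `j` are adjacent through row `j` itself. The pair `(v, v)` needs `hv`, which says
that `v` lies in some row. -/
theorem clique_seed {n m : ℕ} {inc : ℕ → ℕ → ℕ} {j v : ℕ} (hj : j < m) (hv : Adj m inc v v) :
    Clique m inc (seed n m inc j v) := by
  rintro a ⟨-, ⟨ha, hva⟩ | rfl⟩ b ⟨-, ⟨hb, hvb⟩ | rfl⟩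
  · exact ⟨j, hj, ha, hb⟩
  · exact hva.symm
  · exact hvb
  · exact hv

/-- The context of the search, with the adjacency matrix and the trie in memory. -/
structure SearchCtx (w n m : ℕ) (inc : ℕ → ℕ → ℕ) (s : State) : Prop extends Ctx w n m inc s where
  adj : ∀ u < n, ∀ v < n, s.mem (m * n + (u * n + v)) = adjBit m inc u v
  trie : TrieOf n m (m * n + n * n + n) inc s.mem

/-- The memory cells outside the vertex array agree. -/
def SameOutside (n m : ℕ) (s s' : State) : Prop :=
  ∀ a, a < m * n + n * n ∨ m * n + n * n + n ≤ a → s'.mem a = s.mem a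

variable {w n m : ℕ} {inc : ℕ → ℕ → ℕ} {s s' s'' : State}

theorem SameOutside.trans (h : SameOutside n m s s') (h' : SameOutside n m s' s'') :
    SameOutside n m s s'' := fun a ha => (h' a ha).trans (h a ha)

theorem SameOutside.update (h : SameOutside n m s s') {i v : ℕ} {f : ℕ → ℕ} (hi : i < n) :
    SameOutside n m s ⟨f, update s'.mem (m * n + n * n + i) v⟩ := fun a ha => by
  rw [← h a ha]
  exact update_of_ne (by omega) _ _

theorem SameOutside.of_eq (h : s'.mem = s.mem) : SameOutside n m s s' := fun a _ => by rw [h]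

theorem SearchCtx.of_frame (c : SearchCtx w n m inc s) (hF : Frame 7 s s')
    (hm : SameOutside n m s s') : SearchCtx w n m inc s' where
  toCtx := c.toCtx.of_frame hF fun a ha => hm a (Or.inl (by omega))
  adj u hu v hv := by
    have := index_lt hu hv
    rw [hm _ (Or.inl (by omega)), c.adj u hu v hv]
  trie := by
    have h := c.trie
    unfold TrieOf at h ⊢
    rwa [child_congr fun a ha => hm a (Or.inr ha)]

/-! ### Seeds, maximal cliques and lookup -/

theorem runs_seedProg {j v : ℕ} (c : SearchCtx w n m inc s) (hj : j < m) (hv : v < n)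
    (h10 : s.reg 10 = j) (h11 : s.reg 11 = v) :
    Runs w (n * 12 + 4) seedProg s fun s' => Frame 13 s s' ∧ SameOutside n m s s' ∧
      Stores n (m * n + n * n) s'.mem (seed n m inc j v) := by
  have hw := c.word
  have hw0 := c.word_ne_zero
  refine (Runs.seq (T₁ := n * (10 + 2) + 2) (Runs.forLoop (L := 13) (fun k s' => SameOutside n m s s' ∧
    ∀ i < k, s'.mem (m * n + n * n + i) = inc j i * adjBit m inc v i) (by norm_num)
    (by norm_num) (by norm_num) c.r0 c.r2 (by omega) (fun _ _ _ h => h)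
    ⟨SameOutside.of_eq rfl, fun _ h => absurd h (by omega)⟩ ?_) ?_).mono (by omega : _ + 2 ≤ _)
    fun _ h => h
  · intro k s₁ hk hF₁ hk₁ ⟨hm₁, hM⟩
    have c₁ := c.of_frame (fun r hr => hF₁ r (by omega)) hm₁
    have e0 := c₁.r0
    have e3 := c₁.r3
    have e4 := c₁.r4
    have e10 : s₁.reg 10 = j := by rw [hF₁ 10 (by omega), h10]
    have e11 : s₁.reg 11 = v := by rw [hF₁ 11 (by omega), h11]
    have i1 := index_lt hj hk
    have i2 := index_lt hv hk
    have m1 := c₁.row j hj k hk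
    have m2 := c₁.adj v hv k hk
    rw [Nat.add_comm] at m2
    have b1 := c.inc_le j k
    have b2 := adjBit_le m inc v k
    have b3 : inc j k * adjBit m inc v k ≤ 1 := Nat.mul_le_mul b1 b2
    refine Runs.block hF₁ (by simp [Instr.Above]) ?_ ⟨?_, ?_⟩
    · simp [Fits, Instr.value, Instr.apply, e0, e3, e4, e10, e11, hk₁, m1, m2]
      omega
    · simp [Instr.apply, hk₁]
    · simp [Instr.value, Instr.apply, e0, e3, e4, e10, e11, hk₁, m1, m2]
      refine ⟨hm₁.update hk, fun i hi => ?_⟩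
      rcases hi.lt_or_eq with hi | rfl
      · rw [update_of_ne (by omega), hM i hi]
      · rw [update_self]
  · intro s₁ ⟨hF₁, hm₁, hM⟩
    have c₁ := c.of_frame (fun r hr => hF₁ r (by omega)) hm₁
    have e2 := c₁.r2
    have e4 := c₁.r4
    have e11 : s₁.reg 11 = v := by rw [hF₁ 11 (by omega), h11]
    refine Runs.block hF₁ (by simp [Instr.Above]) ?_ ?_
    · simp [Fits, Instr.value, Instr.apply, e2, e4, e11, hw0]
      omega
    · simp [Instr.value, Instr.apply, e2, e4, e11]
      refine ⟨hm₁.update hv, fun i hi => hi.1, fun i hi => ?_, fun i hi => ?_⟩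
      · rcases eq_or_ne i v with rfl | hne
        · simp
        · rw [update_of_ne (by omega), hM i hi]
          exact Nat.mul_le_mul (c.inc_le j i) (adjBit_le m inc v i)
      · rcases eq_or_ne i v with rfl | hne
        · simp [seed, hi]
        · rw [update_of_ne (by omega), hM i hi]
          simp [seed, hi, hne, mul_eq_one, adjBit_eq_one]

/-- One pass over the vertices gives maximality: the clique only grows, so a vertex rejected once
has a non-neighbour in it for good. -/
theorem runs_greedyProg {M₀ : Set ℕ} (c : SearchCtx w n m inc s)
    (hM₀ : Stores n (m * n + n * n) s.mem M₀) (hne : M₀.Nonempty) (hcl : Clique m inc M₀) :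
    Runs w (n * (n * 10 + 9) + 2) greedyProg s fun s' => Frame 13 s s' ∧ SameOutside n m s s' ∧
      ∃ M, Stores n (m * n + n * n) s'.mem M ∧ M₀ ⊆ M ∧ Clique m inc M ∧
        ∀ u < n, (∀ i ∈ M, Adj m inc u i) → u ∈ M := by
  have hw := c.word
  have hw0 := c.word_ne_zero
  refine Runs.forLoop (L := 13) (T := n * 10 + 7) (fun k s' => SameOutside n m s s' ∧
    ∃ M, Stores n (m * n + n * n) s'.mem M ∧ M₀ ⊆ M ∧ Clique m inc M ∧
        ∀ u < k, (∀ i ∈ M, Adj m inc u i) → u ∈ M) (by norm_num)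
    (by norm_num) (by norm_num) c.r0 c.r2 (by omega) (fun _ _ _ h => h)
    ⟨SameOutside.of_eq rfl, M₀, hM₀, subset_rfl, hcl, fun _ h => absurd h (by omega)⟩ ?_
  intro k s₁ hk hF₁ hk₁ ⟨hm₁, M, hM, hMM, hMc, hMk⟩
  have h₂ : Runs w 1 (block [.const 14 1]) s₁ fun s' => Frame 14 s₁ s' ∧ s'.mem = s₁.mem ∧
      s'.reg 14 = 1 :=
    Runs.block (Frame.refl _ _) (by simp [Instr.Above]) (by simp [Fits, Instr.value, hw0])
      (by simp [Instr.apply, Instr.value])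
  refine (h₂.seq (T₂ := (n * (8 + 2) + 2) + (1 + 2)) fun s₂ ⟨hF₂, hm₂, h14⟩ => Runs.seq
    (R := fun s' => Frame 14 s₂ s' ∧ s'.mem = s₁.mem ∧ s'.reg 14 ≤ 1 ∧
      (s'.reg 14 = 1 ↔ ∀ i < n, i ∈ M → Adj m inc k i)) ?_ ?_).mono (by omega) fun _ h => h
  · have hF₁₂ : Frame 13 s s₂ := hF₁.trans hF₂ (by omega)
    have c₂ := c.of_frame (fun r hr => hF₁₂ r (by omega)) (hm₁.trans (.of_eq hm₂))
    refine Runs.forLoop (L := 14) (fun l s' => s'.mem = s₁.mem ∧ s'.reg 14 ≤ 1 ∧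
      (s'.reg 14 = 1 ↔ ∀ i < l, i ∈ M → Adj m inc k i)) (by norm_num)
      (by norm_num) (by norm_num) c₂.r0 c₂.r2 (by omega) (fun _ _ _ h => by simpa using h)
      ⟨hm₂, by omega, by simp [h14]⟩ ?_
    intro l s₃ hl hF₃ hl₃ ⟨hm₃, h14₃, hiff⟩
    have c₃ := c₂.of_frame (fun r hr => hF₃ r (by omega)) (.of_eq (by rw [hm₃, hm₂]))
    have e0 := c₃.r0
    have e3 := c₃.r3
    have e4 := c₃.r4
    have e13 : s₃.reg 13 = k := by rw [hF₃ 13 (by omega), hF₂ 13 (by omega), hk₁]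
    have i1 := index_lt hk hl
    have m1 := c₃.adj k hk l hl
    rw [Nat.add_comm, hm₃] at m1
    have b1 := hM.le l hl
    have b2 := adjBit_le m inc k l
    have h₄ : Runs w 6 (block [.add 16 4 15, .load 16 16, .mul 17 13 0, .add 17 17 15,
        .add 17 17 3, .load 17 17]) s₃ fun s' => Frame 14 s₂ s' ∧ s'.reg 15 = l ∧
          s'.mem = s₁.mem ∧ s'.reg 14 = s₃.reg 14 ∧ s'.reg 16 = s₁.mem (m * n + n * n + l) ∧
          s'.reg 17 = adjBit m inc k l := by
      refine Runs.block hF₃ (by simp [Instr.Above]) ?_ ?_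
      · simp [Fits, Instr.value, Instr.apply, e0, e3, e4, e13, hl₃, hm₃, m1]
        omega
      · simp [Instr.value, Instr.apply, e0, e3, e4, e13, hl₃, hm₃, m1]
    refine h₄.seq (T₂ := 1 + 1) fun s₄ ⟨hF₄, hl₄, hm₄, h14₄, h16, h17⟩ => Runs.ite ?_ ?_
    · intro hb
      simp only [Test.Holds, h16, h17] at hb
      refine Runs.block hF₄ (by simp [Instr.Above]) (by simp [Fits, Instr.value]) ?_
      -- The test compares two bits: adjacency is smaller than membership exactly when `l` is a
      -- member not adjacent to `k`.
      have h1 : l ∈ M := (hM.mem_iff l hl).1 (by omega)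
      have h2 : ¬ Adj m inc k l := fun h => by
        rw [← adjBit_eq_one] at h
        omega
      simp only [List.foldl, Instr.apply, Instr.value]
      refine ⟨by simp [hl₄], hm₄, by simp, ?_⟩
      simp only [update_self, zero_ne_one, false_iff]
      exact fun h => h2 (h l (by omega) h1)
    · intro hb
      simp only [Test.Holds, h16, h17] at hb
      refine (Runs.skip ⟨hF₄, hl₄, hm₄, by rwa [h14₄], ?_⟩).mono (by omega) fun _ h => h
      rw [h14₄, hiff]
      refine ⟨fun h i hi hiM => ?_, fun h i hi => h i (by omega)⟩
      rcases Nat.lt_succ_iff_lt_or_eq.1 hi with hi | rfl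
      · exact h i hi hiM
      · have := (hM.mem_iff i hl).2 hiM
        exact adjBit_eq_one.1 (by omega)
  · rintro s₃ ⟨hF₃, hm₃, h14₃, hiff⟩
    have hF : Frame 14 s₁ s₃ := hF₂.trans hF₃ le_rfl
    have hF' : Frame 13 s s₃ := hF₁.trans hF (by omega)
    have c₃ := c.of_frame (fun r hr => hF' r (by omega)) (hm₁.trans (.of_eq hm₃))
    have e2 := c₃.r2
    have e4 := c₃.r4
    have e13 : s₃.reg 13 = k := by rw [hF 13 (by omega), hk₁]
    refine Runs.ite ?_ ?_
    · intro hb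
      simp only [Test.Holds, e2] at hb
      rw [hiff] at hb
      refine Runs.block hF' (by simp [Instr.Above]) ?_ ?_
      · simp [Fits, Instr.value, Instr.apply, e2, e4, e13, hw0]
        omega
      · simp [Instr.value, Instr.apply, e2, e4, e13, hm₃]
        have hk' : ∀ i ∈ M, Adj m inc k i := fun i hi => hb i (hM.lt i hi) hi
        obtain ⟨a, ha⟩ := hne
        -- The greedy test does not compare `k` with itself unless `k` is already a member.
        -- Nonemptiness supplies a neighbour, hence a row containing `k`.
        have hkk := (hk' a (hMM ha)).refl_left
        refine ⟨hm₁.update hk, insert k M, ⟨?_, fun i hi => ?_, fun i hi => ?_⟩,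
          hMM.trans (Set.subset_insert _ _), ?_, fun u hu hua => ?_⟩
        · rintro i (rfl | hi)
          · exact hk
          · exact hM.lt i hi
        · rcases eq_or_ne i k with rfl | hne
          · simp
          · rw [update_of_ne (by omega)]
            exact hM.le i hi
        · rcases eq_or_ne i k with rfl | hne
          · simp
          · rw [update_of_ne (by omega), hM.mem_iff i hi]
            simp [hne]
        · rintro x (rfl | hx) y (rfl | hy)
          · exact hkk
          · exact hk' y hy
          · exact (hk' x hx).symm
          · exact hMc x hx y hy
        · rcases hu.lt_or_eq with hu | rfl
          · exact Or.inr (hMk u hu fun i hi => hua i (Or.inr hi))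
          · exact Or.inl rfl
    · intro hb
      simp only [Test.Holds, e2] at hb
      rw [hiff] at hb
      refine (Runs.skip ⟨hF', e13, hm₁.trans (.of_eq hm₃), M, by rwa [hm₃], hMM, hMc, ?_⟩).mono
        (by omega) fun _ h => h
      intro u hu hua
      rcases Nat.lt_succ_iff_lt_or_eq.1 hu with hu | rfl
      · exact hMk u hu hua
      · exact absurd (fun i _ hi => hua i hi) hb

/-- The loop needs no early exit: both children of the null node are null, so a failed walk stays at
`0`. -/
theorem runs_lookupProg {f : ℕ → ℕ} (c : SearchCtx w n m inc s) (hf : ∀ i, f i ≤ 1)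
    (hfm : ∀ i < n, s.mem (m * n + n * n + i) = f i) :
    Runs w (n * 8 + 3) lookupProg s fun s' => Frame 13 s s' ∧ s'.mem = s.mem ∧
      s'.reg 14 = walk (child (m * n + n * n + n) s.mem) f n := by
  have hw := c.word
  have hw0 := c.word_ne_zero
  have h₁ : Runs w 1 (block [.const 14 1]) s fun s' => Frame 13 s s' ∧ s'.mem = s.mem ∧
      s'.reg 14 = 1 :=
    Runs.block (Frame.refl _ _) (by simp [Instr.Above]) (by simp [Fits, Instr.value, hw0])
      (by simp [Instr.apply, Instr.value])
  refine (h₁.seq (T₂ := n * (6 + 2) + 2) fun s₁ ⟨hF₁, hm₁, h14⟩ => ?_).mono (by omega) fun _ h => h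
  have c₁ := c.of_frame (fun r hr => hF₁ r (by omega)) (.of_eq hm₁)
  refine (Runs.forLoop (L := 13) (fun k s' => s'.mem = s.mem ∧
    s'.reg 14 = walk (child (m * n + n * n + n) s.mem) f k) (by norm_num)
    (by norm_num) (by norm_num) c₁.r0 c₁.r2 (by omega) (fun _ _ _ h => by simpa using h)
    ⟨hm₁, h14⟩ ?_).mono le_rfl fun s' h => ⟨hF₁.trans h.1 le_rfl, h.2⟩
  intro k s₂ hk hF₂ hk₂ ⟨hm₂, hwk⟩
  have c₂ := c₁.of_frame (fun r hr => hF₂ r (by omega)) (.of_eq (by rw [hm₂, hm₁]))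
  have e4 := c₂.r4
  have e5 := c₂.r5
  have m1 := hfm k hk
  have b1 := hf k
  obtain ⟨⟨N, dep, row, hN, hT⟩, -⟩ := c.trie
  have hle := hT.walk_le hf k
  have hle' := hT.walk_le hf (k + 1)
  rw [← hwk] at hle
  rw [walk, ← hwk, child] at hle'
  have hadr : f k + s₂.reg 14 + s₂.reg 14 + (m * n + n * n + n) =
    m * n + n * n + n + (2 * s₂.reg 14 + f k) := by ring
  refine Runs.block hF₂ (by simp [Instr.Above]) ?_ ?_
  · simp [Fits, Instr.value, Instr.apply, e4, e5, hk₂, hm₂, m1, hadr]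
    omega
  · simp [Instr.value, Instr.apply, e4, e5, hk₂, hm₂, m1, hadr]
    rw [walk, ← hwk, child]

/-- Some row contains all elements of `M`. -/
def Covered (m : ℕ) (inc : ℕ → ℕ → ℕ) (M : Set ℕ) : Prop := ∃ j < m, ∀ i ∈ M, inc j i = 1

/-- The vertex array holds a clique that is not contained in a row. -/
def StoresWitness (n m : ℕ) (inc : ℕ → ℕ → ℕ) (mem : ℕ → ℕ) : Prop :=
  ∃ M, Stores n (m * n + n * n) mem M ∧ Clique m inc M ∧ ¬ Covered m inc M

/-- Success concerns the seed, which lies in the row found; failure exhibits the larger maximal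
clique. If `v` lies in no row there is no seed to test. -/
theorem runs_checkProg {j v : ℕ} (c : SearchCtx w n m inc s) (hj : j < m) (hv : v < n)
    (h10 : s.reg 10 = j) (h11 : s.reg 11 = v) (h12 : s.reg 12 = 1) :
    Runs w (n * (n * 10 + 9) + n * 20 + 16) checkProg s fun s' => Frame 12 s s' ∧
      SameOutside n m s s' ∧
      (s'.reg 12 = 1 ∧ (Adj m inc v v → Covered m inc (seed n m inc j v)) ∨
        s'.reg 12 = 0 ∧ StoresWitness n m inc s'.mem) := by
  have hw := c.word
  have hw0 := c.word_ne_zero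
  have i1 := index_lt hv hv
  have m1 := c.adj v hv v hv
  rw [Nat.add_comm] at m1
  have b1 := adjBit_le m inc v v
  have h₁ : Runs w 4 (block [.mul 13 11 0, .add 13 13 11, .add 13 13 3, .load 13 13]) s
      fun s' => Frame 13 s s' ∧ s'.mem = s.mem ∧ s'.reg 13 = adjBit m inc v v := by
    refine Runs.block (Frame.refl _ _) (by simp [Instr.Above]) ?_ ?_
    · simp [Fits, Instr.value, Instr.apply, c.r0, c.r3, h11, m1]
      omega
    · simp [Instr.value, Instr.apply, c.r0, c.r3, h11, m1]
  refine (h₁.seq (T₂ := 1 + ((n * 12 + 4) + ((n * (n * 10 + 9) + 2) + ((n * 8 + 3) + (1 + 1)))))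
    fun s₁ ⟨hF₁, hm₁, h13⟩ => Runs.ite ?_ ?_).mono (by omega) fun _ h => h
  · intro hb
    have c₁ := c.of_frame (fun r hr => hF₁ r (by omega)) (.of_eq hm₁)
    simp only [Test.Holds, h13, c₁.r2, adjBit_eq_one] at hb
    refine (runs_seedProg c₁ hj hv (by rw [hF₁ 10 (by omega), h10])
      (by rw [hF₁ 11 (by omega), h11])).seq fun s₂ ⟨hF₂, hm₂, hS⟩ => ?_
    have c₂ := c₁.of_frame (fun r hr => hF₂ r (by omega)) hm₂
    refine (runs_greedyProg c₂ hS ⟨v, hv, Or.inr rfl⟩ (clique_seed hj hb)).seq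
      fun s₃ ⟨hF₃, hm₃, M, hM, hMM, hMc, hmax⟩ => ?_
    have c₃ := c₂.of_frame (fun r hr => hF₃ r (by omega)) hm₃
    -- The cells past the vertex array belong to the trie and may exceed `1`. Truncation makes `f` a
    -- bit everywhere and changes nothing below `n`.
    let f : ℕ → ℕ := fun i => min 1 (s₃.mem (m * n + n * n + i))
    have hf : ∀ i, f i ≤ 1 := fun i => min_le_left _ _
    have hfm : ∀ i < n, s₃.mem (m * n + n * n + i) = f i := fun i hi =>
      (min_eq_right (hM.le i hi)).symm
    refine (runs_lookupProg c₃ hf hfm).seq fun s₄ ⟨hF₄, hm₄, h14⟩ => ?_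
    have hF : Frame 13 s s₄ :=
      ((hF₁.trans hF₂ le_rfl).trans hF₃ le_rfl).trans hF₄ le_rfl
    have hm : SameOutside n m s s₄ :=
      (((SameOutside.of_eq hm₁).trans hm₂).trans hm₃).trans (.of_eq hm₄)
    have c₄ := c.of_frame (fun r hr => hF r (by omega)) hm
    have hF' : Frame 12 s s₄ := fun r hr => hF r (by omega)
    have hfM : ∀ i < n, f i = 1 ↔ i ∈ M := fun i hi => by rw [← hfm i hi, hM.mem_iff i hi]
    have hiff := c₃.trie.walk_ne_zero_iff (by omega) hf
    refine Runs.ite ?_ ?_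
    · intro hb
      simp only [Test.Holds, c₄.r6, h14] at hb
      refine (Runs.block hF' (by simp [Instr.Above]) (by simp [Fits, Instr.value]) ?_)
      refine ⟨hm, Or.inr ⟨by simp [Instr.apply, Instr.value], M, ?_, hMc, ?_⟩⟩
      · simpa [Instr.apply, hm₄] using hM
      · rintro ⟨j', hj', hcov⟩
        refine hiff.2 ⟨j', hj', fun i hi => ?_⟩ hb
        have h1 := c.inc_le j' i
        have h2 := hf i
        -- Every member of a covering row `j'` is adjacent, through `j'`, to all of `M`; maximality
        -- puts it in `M`. So `M` equals the row and the lookup would have found it.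
        have h3 : inc j' i = 1 ↔ f i = 1 := by
          rw [hfM i hi]
          exact ⟨fun h => hmax i hi fun i' hi' => ⟨j', hj', h, hcov i' hi'⟩, fun h => hcov i h⟩
        omega
    · intro hb
      simp only [Test.Holds, c₄.r6, h14] at hb
      refine (Runs.skip ⟨hF', hm, Or.inl ⟨by rw [hF 12 (by omega), h12], fun _ => ?_⟩⟩).mono
        (by omega) fun _ h => h
      obtain ⟨j', hj', hrow⟩ := hiff.1 hb
      exact ⟨j', hj', fun i hi => by rw [hrow i hi.1, hfM i hi.1]; exact hMM hi⟩
  · intro hb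
    have hF : Frame 12 s s₁ := fun r hr => hF₁ r (by omega)
    simp only [Test.Holds, h13, hF 2 (by omega), c.r2, adjBit_eq_one] at hb
    exact (Runs.skip ⟨hF, .of_eq hm₁, Or.inl ⟨by rw [hF₁ 12 (by omega), h12],
      fun h => absurd h hb⟩⟩).mono (by omega) fun _ h => h

/-- Once the flag is `0` the remaining rounds only test it, so the witness in the vertex array is
not overwritten. -/
theorem runs_searchProg (c : SearchCtx w n m inc s) :
    Runs w (m * (n * (n * (n * 10 + 9) + n * 20 + 19) + 4) + 3) searchProg s fun s' =>
      Frame 7 s s' ∧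
      (s'.reg 12 = 1 ∧ (∀ j < m, ∀ v < n, Adj m inc v v → Covered m inc (seed n m inc j v)) ∨
        s'.reg 12 = 0 ∧ StoresWitness n m inc s'.mem) := by
  have hw := c.word
  have hw0 := c.word_ne_zero
  let D (b : ℕ) (s' : State) : Prop := SameOutside n m s s' ∧
    (s'.reg 12 = 1 ∧ (∀ j < m, ∀ v < n, j * n + v < b →
      Adj m inc v v → Covered m inc (seed n m inc j v)) ∨
      s'.reg 12 = 0 ∧ StoresWitness n m inc s'.mem)
  have h₁ : Runs w 1 (block [.const 12 1]) s fun s' => Frame 10 s s' ∧ s'.mem = s.mem ∧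
      s'.reg 12 = 1 :=
    Runs.block (Frame.refl _ _) (by simp [Instr.Above]) (by simp [Fits, Instr.value, hw0])
      (by simp [Instr.apply, Instr.value])
  refine (h₁.seq (T₂ := m * ((n * ((1 + (n * (n * 10 + 9) + n * 20 + 16)) + 2) + 2) + 2) + 2)
    fun s₁ ⟨hF₁, hm₁, h12⟩ => ?_).mono ?_ fun _ h => h
  · have c₁ := c.of_frame (fun r hr => hF₁ r (by omega)) (.of_eq hm₁)
    refine (Runs.forLoop (L := 10) (fun k => D (k * n)) (by norm_num) (by norm_num) (by norm_num)
      c₁.r1 c₁.r2 (by omega) (fun _ _ _ h => by simpa [D, SameOutside] using h)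
      ⟨.of_eq hm₁, Or.inl ⟨h12, fun _ _ _ _ h => by omega⟩⟩ ?_).mono le_rfl ?_
    · intro j s₂ hj hF₂ hj₂ hD₂
      have c₂ := c.of_frame (fun r hr => (hF₁.trans hF₂ le_rfl) r (by omega)) hD₂.1
      refine (Runs.forLoop (L := 11) (fun l => D (j * n + l)) (by norm_num) (by norm_num)
        (by norm_num) c₂.r0 c₂.r2 (by omega) (fun _ _ _ h => by simpa [D, SameOutside] using h)
        hD₂ ?_).mono le_rfl ?_
      · intro v s₃ hv hF₃ hv₃ ⟨hm₃, hD₃⟩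
        have c₃ := c.of_frame
          (fun r hr => (hF₁.trans (hF₂.trans hF₃ (by omega)) le_rfl) r (by omega)) hm₃
        refine Runs.ite ?_ ?_
        · intro hb
          simp only [Test.Holds, c₃.r2] at hb
          have hD : ∀ j' < m, ∀ v' < n, j' * n + v' < j * n + v →
              Adj m inc v' v' → Covered m inc (seed n m inc j' v') := by
            rcases hD₃ with h | h
            · exact h.2
            · omega
          refine (runs_checkProg c₃ hj hv (by rw [hF₃ 10 (by omega), hj₂]) hv₃ hb).mono le_rfl ?_
          rintro s₄ ⟨hF₄, hm₄, h⟩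
          refine ⟨hF₃.trans hF₄ (by omega), by rw [hF₄ 11 (by omega), hv₃], hm₃.trans hm₄,
            h.imp_left fun ⟨h1, h2⟩ => ⟨h1, fun j' hj' v' hv' hlt => ?_⟩⟩
          rcases (by omega : j' * n + v' < j * n + v ∨ j' * n + v' = j * n + v) with h | h
          · exact hD j' hj' v' hv' h
          · obtain ⟨rfl, rfl⟩ := index_inj hv' hv h
            exact h2
        · intro hb
          simp only [Test.Holds, c₃.r2] at hb
          exact (Runs.skip ⟨hF₃, hv₃, hm₃, Or.inr (hD₃.resolve_left fun h => hb h.1)⟩).mono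
            (by omega) fun _ h => h
      · rintro s₃ ⟨hF₃, hD₃⟩
        exact ⟨hF₂.trans hF₃ (by omega), by rw [hF₃ 10 (by omega), hj₂],
          by rwa [Nat.add_mul, Nat.one_mul]⟩
    · rintro s₂ ⟨hF₂, -, h⟩
      exact ⟨fun r hr => (hF₁.trans hF₂ le_rfl) r (by omega), h.imp_left fun ⟨h1, h2⟩ =>
        ⟨h1, fun j hj v hv => h2 j hj v hv (index_lt hj hv)⟩⟩
  · refine le_of_eq ?_
    ring

/-! ### The whole program and its running time -/

theorem runs_conformalProg {w n m : ℕ} {inc : ℕ → ℕ → ℕ} {s : State} (h0 : s.reg 0 = n)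
    (h1 : s.reg 1 = m) (h6 : s.reg 6 = 0) (hinc : ∀ j i, inc j i ≤ 1)
    (hrow : ∀ j < m, ∀ i < n, s.mem (j * n + i) = inc j i) (hz : ∀ a, m * n ≤ a → s.mem a = 0)
    (hw : 4 * (m * n) + n * n + n + m + 8 ≤ 2 ^ w) :
    Runs w (130 * max 1 (m * n ^ 3)) conformalProg s fun s' =>
      s'.reg 0 = 1 ∧ (0 < m * n → ∀ j < m, ∀ v < n, Adj m inc v v →
        Covered m inc (seed n m inc j v)) ∨
      s'.reg 0 = 0 ∧ s'.reg 1 = m * n + n * n ∧ 0 < m * n ∧ StoresWitness n m inc s'.mem := by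
  have hw0 : w ≠ 0 := by
    rintro rfl
    omega
  have h₁ : Runs w 2 (block [.const 2 1, .mul 3 1 0]) s fun s' => Frame 2 s s' ∧
      s'.mem = s.mem ∧ s'.reg 2 = 1 ∧ s'.reg 3 = m * n ∧ s'.reg 6 = 0 := by
    refine Runs.block (Frame.refl _ _) (by simp [Instr.Above]) ?_ ?_
    · simp [Fits, Instr.value, Instr.apply, h0, h1, hw0]
      omega
    · simp [Instr.value, Instr.apply, h0, h1, h6]
  let T := (n * (n * (m * 10 + 9) + 4) + 2) + ((m * (n * 13 + 5) + 3) +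
    ((m * (n * (n * (n * 10 + 9) + n * 20 + 19) + 4) + 3) + 2))
  rcases Nat.eq_zero_or_pos (m * n) with hmn | hmn
  · refine (h₁.seq (T₂ := 1 + 1) fun s₁ ⟨hF₁, hm₁, e2, e3, e6⟩ => Runs.ite ?_ ?_).mono
      (by omega) fun _ h => h
    · intro hb
      simp only [Test.Holds, e6, e3] at hb
      omega
    · intro hb
      -- Frame level `0` protects nothing, as the answer goes to register `0`.
      refine (Runs.block (Frame.refl 0 _) (by simp [Instr.Above])
        (by simp [Fits, Instr.value, hw0]) ?_).mono le_rfl fun _ h => h.2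
      exact Or.inl ⟨by simp [Instr.apply, Instr.value], fun h => by omega⟩
  · refine (h₁.seq (T₂ := 1 + (3 + T)) fun s₁ ⟨hF₁, hm₁, e2, e3, e6⟩ => Runs.ite ?_ ?_).mono
      ?_ fun _ h => h
    · intro hb
      have e0 : s₁.reg 0 = n := by rw [hF₁ 0 (by omega), h0]
      have e1 : s₁.reg 1 = m := by rw [hF₁ 1 (by omega), h1]
      have h₂ : Runs w 3 (block [.mul 4 0 0, .add 4 3 4, .add 5 4 0]) s₁ fun s' => Frame 4 s₁ s' ∧
          s'.mem = s.mem ∧ s'.reg 4 = m * n + n * n ∧ s'.reg 5 = m * n + n * n + n ∧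
          s'.reg 6 = 0 := by
        refine Runs.block (Frame.refl _ _) (by simp [Instr.Above]) ?_ ?_
        · simp [Fits, Instr.value, Instr.apply, e0, e3]
          omega
        · simp [Instr.value, Instr.apply, e0, e3, e6, hm₁]
      refine h₂.seq fun s₂ ⟨hF₂, hm₂, e4, e5, e6⟩ => ?_
      have c₂ : Ctx w n m inc s₂ :=
        ⟨by rw [hF₂ 0 (by omega), e0], by rw [hF₂ 1 (by omega), e1], by rw [hF₂ 2 (by omega), e2],
          by rw [hF₂ 3 (by omega), e3], e4, e5, e6, hinc, by rwa [hm₂], hw⟩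
      refine (runs_adjacencyProg c₂).seq fun s₃ ⟨hF₃, hm₃, hadj⟩ => ?_
      have c₃ := c₂.of_frame hF₃ fun a ha => hm₃ a (Or.inl ha)
      refine (runs_trieProg c₃ fun a ha => ?_).seq fun s₄ ⟨hF₄, hm₄, htrie⟩ => ?_
      · rw [hm₃ a (Or.inr (by omega)), hm₂, hz a (by omega)]
      have c₄ : SearchCtx w n m inc s₄ :=
        ⟨c₃.of_frame hF₄ fun a ha => hm₄ a (by omega), fun u hu v hv => by
          have := index_lt hu hv
          rw [hm₄ _ (by omega), hadj u hu v hv], htrie⟩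
      refine (runs_searchProg c₄).seq fun s₅ ⟨hF₅, h⟩ => ?_
      have e4 : s₅.reg 4 = m * n + n * n := by rw [hF₅ 4 (by omega), c₄.r4]
      have e6 : s₅.reg 6 = 0 := by rw [hF₅ 6 (by omega), c₄.r6]
      have h12 : s₅.reg 12 ≤ 1 := by omega
      refine (Runs.block (Frame.refl 0 _) (by simp [Instr.Above]) ?_ ?_).mono le_rfl fun _ h => h.2
      · simp [Fits, Instr.value, Instr.apply, e4, e6]
        omega
      · simp only [List.foldl, Instr.value, Instr.apply]
        refine h.imp (fun h => ⟨by simp [e6, h.1], fun _ => h.2⟩) fun h =>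
          ⟨by simp [e6, h.1], by simp [e4, e6], hmn, h.2⟩
    · intro hb
      simp only [Test.Holds, e6, e3] at hb
      omega
    · have hm : 1 ≤ m := Nat.pos_of_mul_pos_right hmn
      have hn : 1 ≤ n := Nat.pos_of_mul_pos_left hmn
      -- As `m, n ≥ 1`, each monomial of the bound is at most `m * n ^ 3`. The coefficients add up
      -- to `119`, within the `130` allowed.
      have mono : ∀ {a b : ℕ}, a ≤ 1 → b ≤ 3 → m ^ a * n ^ b ≤ m * n ^ 3 := fun ha hb =>
        Nat.mul_le_mul ((Nat.pow_le_pow_right hm ha).trans_eq (pow_one m))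
          (Nat.pow_le_pow_right hn hb)
      have a1 := mono (a := 1) (b := 2) (by omega) (by omega)
      have a2 := mono (a := 1) (b := 1) (by omega) (by omega)
      have a3 := mono (a := 1) (b := 0) (by omega) (by omega)
      have a4 := mono (a := 0) (b := 2) (by omega) (by omega)
      have a5 := mono (a := 0) (b := 1) (by omega) (by omega)
      have a6 := mono (a := 0) (b := 0) (by omega) (by omega)
      have a7 := le_max_right 1 (m * n ^ 3)
      simp only [T]
      linarith

/-! ### Correctness of the criterion -/

/-- If `M` lies in row `j`, then `insert v M` lies in the seed of `j` and `v`, which is covered by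
assumption. The empty clique is where `hm` enters. -/
theorem covered_of_clique {n m : ℕ} {inc : ℕ → ℕ → ℕ} (hm : 0 < m)
    (h : ∀ j < m, ∀ v < n, Adj m inc v v → Covered m inc (seed n m inc j v)) (M : Finset ℕ)
    (hM : ∀ i ∈ M, i < n) (hc : Clique m inc M) : Covered m inc M := by
  induction M using Finset.induction_on with
  | empty => exact ⟨0, hm, by simp⟩
  | insert v M hv ih =>
    have hmem : ∀ i ∈ M, i ∈ insert v M := fun i hi => Finset.mem_insert_of_mem hi
    obtain ⟨j, hj, hjM⟩ := ih (fun i hi => hM i (hmem i hi))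
      fun a ha b hb => hc a (hmem a ha) b (hmem b hb)
    have hv' : v ∈ insert v M := Finset.mem_insert_self v M
    obtain ⟨j', hj', hcov⟩ := h j hj v (hM v hv') (hc v hv' v hv')
    refine ⟨j', hj', fun i hi => hcov i ⟨hM i hi, ?_⟩⟩
    rcases Finset.mem_insert.1 hi with rfl | hi'
    · exact Or.inr rfl
    · exact Or.inl ⟨hjM i hi', hc v hv' i hi⟩

/-! ### Translation between matrices and hypergraphs -/

/-- The matrix `inc` is the incidence matrix of the vertices `x` and the edges `e`. -/
def IsIncidence {α : Type*} {n m : ℕ} (x : Fin n → α) (e : Fin m → Set α) (inc : ℕ → ℕ → ℕ) :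
    Prop :=
  ∀ (j : Fin m) (i : Fin n), inc j i = 1 ↔ x i ∈ e j

variable {α : Type*} {H : Hypergraph α} {n m : ℕ} {x : Fin n → α} {e : Fin m → Set α}
  {inc : ℕ → ℕ → ℕ}

/-- The case `m * n = 0` is included: the empty `S` gets its edge from the pair condition itself,
and a nonempty `S` has a vertex in an edge, which forces `0 < m * n`. -/
theorem isConformal_of_covered (hx : Set.range x = H.vertexSet) (he : Set.range e = H.edgeSet)
    (hinc : IsIncidence x e inc)
    (h : 0 < m * n → ∀ j < m, ∀ v < n, Adj m inc v v → Covered m inc (seed n m inc j v)) :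
    H.IsConformal 2 := by
  classical
  intro S hS
  refine ⟨fun ⟨E, hE, hSE⟩ S' hS' _ => ⟨E, hE, hS'.trans hSE⟩, fun h2 => ?_⟩
  rcases S.eq_empty_or_nonempty with rfl | ⟨y, hy⟩
  · exact h2 ∅ subset_rfl (by simp)
  have hpair : ∀ a b : Fin n, x a ∈ S → x b ∈ S → Adj m inc a b := by
    intro a b ha hb
    obtain ⟨E, hE, hab⟩ := h2 {x a, x b} (Set.insert_subset ha (Set.singleton_subset_iff.2 hb))
      ((Set.encard_insert_le _ _).trans (by rw [Set.encard_singleton]; norm_num))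
    rw [← he] at hE
    obtain ⟨j, rfl⟩ := hE
    exact ⟨j, j.2, (hinc j a).2 (hab (by simp)), (hinc j b).2 (hab (by simp))⟩
  obtain ⟨i₀, rfl⟩ : y ∈ Set.range x := hx ▸ hS hy
  obtain ⟨j₀, hj₀, -⟩ := hpair i₀ i₀ hy hy
  have hm : 0 < m := by omega
  have hn : 0 < n := i₀.pos
  let M : Finset ℕ := (Finset.univ.filter fun i => x i ∈ S).image ((↑) : Fin n → ℕ)
  have hM : ∀ k, k ∈ M ↔ ∃ i : Fin n, x i ∈ S ∧ (i : ℕ) = k := fun k => by simp [M]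
  obtain ⟨j, hj, hcov⟩ := covered_of_clique hm (h (Nat.mul_pos hm hn)) M
    (fun k hk => by
      obtain ⟨i, -, rfl⟩ := (hM k).1 hk
      exact i.2)
    (fun k hk l hl => by
      obtain ⟨i, hi, rfl⟩ := (hM k).1 hk
      obtain ⟨i', hi', rfl⟩ := (hM l).1 hl
      exact hpair i i' hi hi')
  refine ⟨e ⟨j, hj⟩, he ▸ Set.mem_range_self _, fun y hy => ?_⟩
  obtain ⟨i, rfl⟩ : y ∈ Set.range x := hx ▸ hS hy
  exact (hinc ⟨j, hj⟩ i).1 (hcov i ((hM i).2 ⟨i, hy, rfl⟩))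

theorem isNonconformalityWitness_of_clique (hx : Set.range x = H.vertexSet)
    (he : Set.range e = H.edgeSet) (hinc : IsIncidence x e inc) (hm : 0 < m) {M : Set ℕ}
    (hM : ∀ i ∈ M, i < n) (hc : Clique m inc M) (hcov : ¬ Covered m inc M) :
    H.IsNonconformalityWitness 2 (x '' {i | (i : ℕ) ∈ M}) := by
  refine ⟨hx ▸ Set.image_subset_range _ _, fun S' hS' hcard => ?_, fun E hE hSE => ?_⟩
  · have key : ∀ a b : Fin n, (a : ℕ) ∈ M → (b : ℕ) ∈ M → S' ⊆ {x a, x b} →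
        ∃ E' ∈ H.edgeSet, S' ⊆ E' := by
      intro a b ha hb hab
      obtain ⟨j, hj, h1, h2⟩ := hc a ha b hb
      refine ⟨e ⟨j, hj⟩, he ▸ Set.mem_range_self _, hab.trans (Set.insert_subset ?_ ?_)⟩
      · exact (hinc ⟨j, hj⟩ a).1 h1
      · exact Set.singleton_subset_iff.2 ((hinc ⟨j, hj⟩ b).1 h2)
    rcases S'.eq_empty_or_nonempty with rfl | ⟨y, hy⟩
    · exact ⟨e ⟨0, hm⟩, he ▸ Set.mem_range_self _, Set.empty_subset _⟩
    obtain ⟨a, ha, rfl⟩ := hS' hy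
    by_cases hb : ∃ z ∈ S', z ≠ x a
    · obtain ⟨z, hz, hne⟩ := hb
      obtain ⟨b, hb, rfl⟩ := hS' hz
      refine key a b ha hb ?_
      -- Two distinct elements exhaust a set of at most two.
      have hsub : {x a, x b} ⊆ S' := Set.insert_subset hy (Set.singleton_subset_iff.2 hz)
      have hfin : S'.Finite := Set.finite_of_encard_le_coe hcard
      refine (hfin.eq_of_subset_of_encard_le' hsub ?_).symm.subset
      rwa [Set.encard_pair hne.symm]
    · push Not at hb
      exact key a a ha ha fun z hz => by simp [hb z hz]
  · rw [← he] at hE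
    obtain ⟨j, rfl⟩ := hE
    refine hcov ⟨j, j.2, fun i hi => ?_⟩
    exact (hinc j ⟨i, hM i hi⟩).2 (hSE ⟨⟨i, hM i hi⟩, hi, rfl⟩)

/-- The left side exceeds every value written: the trie has at most `1 + m * n` nodes with two cells
each, placed after the two matrices and the vertex array. It is at most `4 * (n + m + 2) ^ 2`, hence
at most `(n + m + 2) ^ 4`. -/
theorem word_length_sufficient (n m : ℕ) :
    4 * (m * n) + n * n + n + m + 8 ≤ 2 ^ (4 * Nat.clog 2 (n + m + 2)) := by
  have h1 : n + m + 2 ≤ 2 ^ Nat.clog 2 (n + m + 2) := Nat.le_pow_clog (by norm_num) _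
  calc 4 * (m * n) + n * n + n + m + 8 ≤ 2 ^ 2 * (n + m + 2) ^ 2 := by nlinarith
    _ ≤ (n + m + 2) ^ 2 * (n + m + 2) ^ 2 :=
      Nat.mul_le_mul_right _ (Nat.pow_le_pow_left (by omega) 2)
    _ = (n + m + 2) ^ 4 := by ring
    _ ≤ (2 ^ Nat.clog 2 (n + m + 2)) ^ 4 := Nat.pow_le_pow_left h1 4
    _ = 2 ^ (4 * Nat.clog 2 (n + m + 2)) := by rw [← pow_mul, Nat.mul_comm]

end WordRAM

/-- There are one program `P` and constants `c`, `C` such that, for every finite hypergraph `H` with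
`n` vertices and `m` edges, given by its incidence matrix (with vertices and edges in any order),
the program halts within `C * max 1 (m * n ^ 3)` steps on words of `c * ⌈log₂ (n + m + 2)⌉` bits.
If `H` is conformal, it answers `1`; otherwise it answers `0` and returns the
characteristic vector of a counterexample, in the cells starting from the address in register `1`. -/
theorem theorem6 :
    ∃ (P : WordRAM.Prog) (c C : ℕ), ∀ (α : Type*) (H : Hypergraph α) (n m : ℕ)
      (x : Fin n → α) (e : Fin m → Set α),
      Function.Injective x → Set.range x = H.vertexSet →
      Function.Injective e → Set.range e = H.edgeSet →
      ∃ (t : ℕ) (s : WordRAM.State),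
        WordRAM.Exec (c * Nat.clog 2 (n + m + 2)) P (WordRAM.incidenceInput x e) t s ∧
        t ≤ C * max 1 (m * n ^ 3) ∧
        (H.IsConformal 2 → s.reg 0 = 1) ∧
        (¬ H.IsConformal 2 → s.reg 0 = 0 ∧
          ∃ S : Set α, H.IsNonconformalityWitness 2 S ∧
            ∀ i : Fin n, (x i ∈ S → s.mem (s.reg 1 + i) = 1) ∧
              (x i ∉ S → s.mem (s.reg 1 + i) = 0)) := by
  refine ⟨WordRAM.conformalProg, 4, 130, fun α H n m x e hx hxr _ her => ?_⟩
  classical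
  -- Extending the matrix by `0` makes its entries bits at all indices.
  let inc : ℕ → ℕ → ℕ := fun j i =>
    if ∃ (hj : j < m) (hi : i < n), x ⟨i, hi⟩ ∈ e ⟨j, hj⟩ then 1 else 0
  have hinc : WordRAM.IsIncidence x e inc := fun j i => by simp [inc]
  have hrow : ∀ j < m, ∀ i < n, (WordRAM.incidenceInput x e).mem (j * n + i) = inc j i := by
    intro j hj i hi
    simp only [WordRAM.incidenceInput, inc]
    refine if_congr ⟨?_, fun ⟨_, _, h⟩ => ⟨⟨j, hj⟩, ⟨i, hi⟩, rfl, h⟩⟩ rfl rfl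
    rintro ⟨j', i', heq, h⟩
    obtain ⟨rfl, rfl⟩ := WordRAM.index_inj hi i'.2 heq
    exact ⟨hj, hi, h⟩
  have hz : ∀ a, m * n ≤ a → (WordRAM.incidenceInput x e).mem a = 0 := by
    intro a ha
    refine if_neg ?_
    rintro ⟨j, i, rfl, -⟩
    have := WordRAM.index_lt j.2 i.2
    omega
  obtain ⟨t, s, hexec, ht, h⟩ := WordRAM.runs_conformalProg (s := WordRAM.incidenceInput x e)
    (inc := inc) rfl rfl rfl (fun j i => by simp only [inc]; split_ifs <;> omega) hrow hz
    (WordRAM.word_length_sufficient n m)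
  refine ⟨t, s, hexec, ht, ?_⟩
  rcases h with ⟨h0, hcov⟩ | ⟨h0, h1, hmn, M, hM, hc, hcov⟩
  · exact ⟨fun _ => h0, fun hn => absurd (WordRAM.isConformal_of_covered hxr her hinc hcov) hn⟩
  · have hW := WordRAM.isNonconformalityWitness_of_clique hxr her hinc
      (Nat.pos_of_mul_pos_right hmn) hM.lt hc hcov
    refine ⟨fun hconf => ?_, fun _ => ⟨h0, _, hW, fun i => ?_⟩⟩
    · obtain ⟨E, hE, hSE⟩ := (hconf _ hW.1).2 hW.2.1
      exact absurd hSE (hW.2.2 E hE)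
    · have hi : x i ∈ x '' {i | (i : ℕ) ∈ M} ↔ (i : ℕ) ∈ M := hx.mem_set_image
      have h2 := hM.mem_iff i i.2
      have h3 := hM.le i i.2
      rw [h1, hi]
      exact ⟨fun h => h2.2 h, fun h => by
        have := mt h2.1 h
        omega⟩
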